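/- Let $H$ be a real or complex Hilbert space and let $T : D(T) \subseteq H \to H$ be a densely defined closed linear operator, with null space $N(T)$, range $R(T)$ and adjoint $T^*$. Products of unbounded operators carry their natural domains, $D(AB) = \{x \in D(B) : Bx \in D(A)\}$, with $T^0 = I$ and $T^{n+1} = T\,T^n$, and equality of operators includes equality of domains. The Moore–Penrose inverse $S^\dagger$ of a closed operator $S$ is the linear operator with domain $R(S) \oplus R(S)^\perp$ given by $S^\dagger y = (S|_{D(S) \cap N(S)^\perp})^{-1} y$ for $y \in R(S)$ and $S^\dagger y = 0$ for $y \in R(S)^\perp$. For a densely defined closed operator $S$ on $H$, the generalized Cauchy dual is $w(S) = S (S^*S)^\dagger$. Assume that $T$ is quasinormal, i.e. $T(T^*T) = (T^*T)T$, and EP, i.e. $R(T)$ is closed and $R(T) = R(T^*)$. Then for every integer $n \ge 0$ the operator $T^n$ is densely defined and closed (so that $w(T^n)$ is defined), and $$ w(T^n) = (w(T))^n . $$ -/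

import Mathlib

/-! Unbounded operators between Hilbert spaces are Mathlib's partially defined linear maps
`E →ₗ.[𝕜] F`; an equality of such maps includes equality of the domains, and `LinearPMap.adjoint`
is the adjoint of a densely defined operator. -/

namespace UnboundedOp

section Algebra

variable {𝕜 E F G : Type*} [Field 𝕜] [AddCommGroup E] [Module 𝕜 E]
  [AddCommGroup F] [Module 𝕜 F] [AddCommGroup G] [Module 𝕜 G]

/-- The null space `N(T) = {x ∈ D(T) : T x = 0}`, as a subspace of the ambient space. -/
def ker (T : E →ₗ.[𝕜] F) : Submodule 𝕜 E := (LinearMap.ker T.toFun).map T.domain.subtype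

/-- The range `R(T) = {T x : x ∈ D(T)}`. -/
def range (T : E →ₗ.[𝕜] F) : Submodule 𝕜 F := LinearMap.range T.toFun

theorem mem_ker_iff {T : E →ₗ.[𝕜] F} {x : E} :
    x ∈ ker T ↔ ∃ h : x ∈ T.domain, T ⟨x, h⟩ = 0 := by
  simp only [ker, Submodule.mem_map, LinearMap.mem_ker, Submodule.subtype_apply]
  constructor
  · rintro ⟨⟨y, hy⟩, h, rfl⟩
    exact ⟨hy, h⟩
  · rintro ⟨hx, h⟩
    exact ⟨⟨x, hx⟩, h, rfl⟩

theorem mem_range_iff {T : E →ₗ.[𝕜] F} {y : F} : y ∈ range T ↔ ∃ x : T.domain, T x = y :=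
  Iff.rfl

/-- The subspace `{x ∈ D(S) : S x ∈ D(T)}`. -/
def compDomain (T : F →ₗ.[𝕜] G) (S : E →ₗ.[𝕜] F) : Submodule 𝕜 E :=
  (T.domain.comap S.toFun).map S.domain.subtype

theorem mem_compDomain_iff {T : F →ₗ.[𝕜] G} {S : E →ₗ.[𝕜] F} {x : E} :
    x ∈ compDomain T S ↔ ∃ h : x ∈ S.domain, S ⟨x, h⟩ ∈ T.domain := by
  simp only [compDomain, Submodule.mem_map, Submodule.mem_comap, Submodule.subtype_apply]
  constructor
  · rintro ⟨⟨y, hy⟩, h, rfl⟩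
    exact ⟨hy, h⟩
  · rintro ⟨hx, h⟩
    exact ⟨⟨x, hx⟩, h, rfl⟩

/-- The product `T S` of unbounded operators, `x ↦ T (S x)` on its natural domain
`D(TS) = {x ∈ D(S) : S x ∈ D(T)}`. -/
def comp (T : F →ₗ.[𝕜] G) (S : E →ₗ.[𝕜] F) : E →ₗ.[𝕜] G :=
  T.comp (S.domRestrict (compDomain T S)) fun x => by
    obtain ⟨_, h⟩ := mem_compDomain_iff.1 x.2.1
    exact h

theorem mem_comp_domain_iff {T : F →ₗ.[𝕜] G} {S : E →ₗ.[𝕜] F} {x : E} :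
    x ∈ (comp T S).domain ↔ ∃ h : x ∈ S.domain, S ⟨x, h⟩ ∈ T.domain := by
  refine Iff.trans ?_ mem_compDomain_iff
  exact ⟨fun h => h.1, fun h => ⟨h, (mem_compDomain_iff.1 h).1⟩⟩

theorem comp_apply {T : F →ₗ.[𝕜] G} {S : E →ₗ.[𝕜] F} {x : E} (h : x ∈ (comp T S).domain)
    (hS : x ∈ S.domain) (hT : S ⟨x, hS⟩ ∈ T.domain) :
    comp T S ⟨x, h⟩ = T ⟨S ⟨x, hS⟩, hT⟩ := rfl

/-- The powers `T ^ n` on their natural domains: `T ^ 0 = I` on the whole space and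
`T ^ (n + 1) = T T ^ n`. -/
def pow (T : E →ₗ.[𝕜] E) : ℕ → (E →ₗ.[𝕜] E)
  | 0 => (LinearMap.id : E →ₗ[𝕜] E).toPMap ⊤
  | n + 1 => comp T (pow T n)

end Algebra

section Hilbert

variable {𝕜 E F : Type*} [RCLike 𝕜] [NormedAddCommGroup E] [InnerProductSpace 𝕜 E]
  [NormedAddCommGroup F] [InnerProductSpace 𝕜 F]

/-- The restriction of `T` to its carrier `C(T) = D(T) ∩ N(T)ᗮ`. -/
def carrierRestrict (T : E →ₗ.[𝕜] F) : E →ₗ.[𝕜] F := T.domRestrict (ker T)ᗮ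

/-- The restriction to the carrier is injective, so that its inverse is the genuine one. -/
theorem ker_carrierRestrict (T : E →ₗ.[𝕜] F) :
    LinearMap.ker (carrierRestrict T).toFun = ⊥ := by
  rw [LinearMap.ker_eq_bot']
  rintro ⟨x, hx⟩ h
  have hx' : x ∈ (ker T)ᗮ ⊓ T.domain := hx
  have hk : x ∈ ker T := mem_ker_iff.2 ⟨hx'.2, h⟩
  have : x = 0 := by
    have := hx'.1 x hk
    exact inner_self_eq_zero.1 this
  exact Subtype.ext this

/-- The Moore-Penrose inverse: `(T|_{C(T)})⁻¹` on `T(C(T))`, which is `R(T)` for closed `T`,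
and `0` on `R(T)ᗮ`, extended linearly to the sum of the two subspaces. -/
noncomputable def mpInverse (T : E →ₗ.[𝕜] F) : F →ₗ.[𝕜] E :=
  LinearPMap.sup (carrierRestrict T).inverse ((0 : F →ₗ[𝕜] E).toPMap (range T)ᗮ) <| by
    rintro ⟨x, hx⟩ ⟨y, hy⟩ (rfl : x = y)
    have hR : x ∈ range T := by
      rw [LinearPMap.inverse_domain] at hx
      obtain ⟨⟨z, hz⟩, rfl⟩ := hx
      have hz' : z ∈ (ker T)ᗮ ⊓ T.domain := hz
      exact ⟨⟨z, hz'.2⟩, rfl⟩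
    have h0 : x = 0 := inner_self_eq_zero.1 (hy x hR)
    subst h0
    exact LinearPMap.map_zero _

/-- The generalized Cauchy dual `w(T) = T (T* T)^†`. -/
noncomputable def cauchyDual [CompleteSpace E] (T : E →ₗ.[𝕜] F) : E →ₗ.[𝕜] F :=
  comp T (mpInverse (comp T.adjoint T))

/-- A densely defined closed operator `T` is quasinormal if it commutes with `T* T`,
that is, `T (T* T) = (T* T) T` (with equality of domains). -/
def IsQuasinormal [CompleteSpace E] (T : E →ₗ.[𝕜] E) : Prop :=
  comp T (comp T.adjoint T) = comp (comp T.adjoint T) T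

/-- A densely defined closed operator `T` is EP if `R(T)` is closed and `R(T) = R(T*)`. -/
def IsEP [CompleteSpace E] (T : E →ₗ.[𝕜] E) : Prop :=
  IsClosed (range T : Set E) ∧ range T = range T.adjoint

end Hilbert

end UnboundedOp

/-!
The proof replaces the unbounded operators by bounded ones. If `R = R(T)` is closed and equal to
`R(T*)`, then `N(T) = Rᗮ`, so `T` is the direct sum of the zero operator on `Rᗮ` and of a
bijection `D(T) ∩ R → R`, whose inverse is bounded by the closed graph theorem. Extending this
inverse by `0` on `Rᗮ` gives a bounded operator `C` with
`(x, y) ∈ graph T ↔ y ∈ R ∧ P x = C y`, where `P` is the orthogonal projection onto `R`. This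
relation is `HasReducedInverse T R C`, and `HasReducedInverse.of_isEP` establishes it.

The relation is stable under all the operations that occur: the adjoint of `T` corresponds to `C*`
(`HasReducedInverse.adjoint`), products correspond to products in the opposite order
(`HasReducedInverse.comp`), and the Moore-Penrose inverse of `T` is `C`, defined everywhere
(`HasReducedInverse.mpInverse_eq`). Thus `(T* T)^† = C C*`, whence `w(T) = T C C* = C*`
(`HasReducedInverse.cauchyDual_eq`). Since `T ^ n` corresponds to `C ^ n` for `n ≥ 1`, it follows
that `w(T ^ n) = (C ^ n)* = (C*) ^ n = w(T) ^ n`. For `n = 0` the identity corresponds to itself,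
with `R` the whole space.
-/

namespace UnboundedOp

section Algebra

variable {𝕜 E F G : Type*} [Field 𝕜] [AddCommGroup E] [Module 𝕜 E]
  [AddCommGroup F] [Module 𝕜 F] [AddCommGroup G] [Module 𝕜 G]

/-! ### Graphs of products and powers -/

theorem mem_graph_iff_exists_mem_domain {T : E →ₗ.[𝕜] F} {x : E} {y : F} :
    (x, y) ∈ T.graph ↔ ∃ h : x ∈ T.domain, T ⟨x, h⟩ = y := by
  simp [LinearPMap.mem_graph_iff]

theorem mem_graph_comp_iff {T : F →ₗ.[𝕜] G} {S : E →ₗ.[𝕜] F} {x : E} {z : G} :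
    (x, z) ∈ (comp T S).graph ↔ ∃ y, (x, y) ∈ S.graph ∧ (y, z) ∈ T.graph := by
  simp only [mem_graph_iff_exists_mem_domain]
  constructor
  · rintro ⟨h, rfl⟩
    obtain ⟨hS, hT⟩ := mem_comp_domain_iff.1 h
    exact ⟨_, ⟨hS, rfl⟩, hT, (comp_apply h hS hT).symm⟩
  · rintro ⟨_, ⟨hS, rfl⟩, hT, rfl⟩
    have h := mem_comp_domain_iff.2 ⟨hS, hT⟩
    exact ⟨h, comp_apply h hS hT⟩

theorem mem_graph_toPMap_top_iff {A : E →ₗ[𝕜] F} {x : E} {y : F} :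
    (x, y) ∈ (A.toPMap ⊤).graph ↔ y = A x := by
  simp [LinearPMap.mem_graph_iff, eq_comm]

theorem comp_id_toPMap_top (T : E →ₗ.[𝕜] F) :
    comp T ((LinearMap.id : E →ₗ[𝕜] E).toPMap ⊤) = T := by
  apply LinearPMap.eq_of_eq_graph
  ext ⟨x, z⟩
  simp only [mem_graph_comp_iff, mem_graph_toPMap_top_iff, exists_eq_left, LinearMap.id_apply]

theorem pow_toPMap_top (A : E →ₗ[𝕜] E) (n : ℕ) : pow (A.toPMap ⊤) n = (A ^ n).toPMap ⊤ := by
  induction n with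
  | zero => rfl
  | succ n ih =>
    apply LinearPMap.eq_of_eq_graph
    ext ⟨x, z⟩
    rw [pow, ih, mem_graph_comp_iff]
    simp only [mem_graph_toPMap_top_iff, exists_eq_left, pow_succ', Module.End.mul_apply]

theorem mem_ker_iff_mem_graph {T : E →ₗ.[𝕜] F} {x : E} : x ∈ ker T ↔ (x, (0 : F)) ∈ T.graph := by
  rw [mem_ker_iff, mem_graph_iff_exists_mem_domain]

theorem mem_range_iff_exists_mem_graph {T : E →ₗ.[𝕜] F} {y : F} :
    y ∈ range T ↔ ∃ x, (x, y) ∈ T.graph := by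
  simp [mem_range_iff]

end Algebra

variable {𝕜 H : Type*} [RCLike 𝕜] [NormedAddCommGroup H] [InnerProductSpace 𝕜 H]

local notation "⟪" x ", " y "⟫" => inner 𝕜 x y

/-! ### Adjoints and null spaces -/

theorem mem_graph_adjoint_iff [CompleteSpace H] {T : H →ₗ.[𝕜] H}
    (hT : Dense (T.domain : Set H)) {y z : H} :
    (y, z) ∈ T.adjoint.graph ↔ ∀ a b, (a, b) ∈ T.graph → ⟪b, y⟫ = ⟪a, z⟫ := by
  simp only [LinearPMap.adjoint_graph_eq_graph_adjoint hT, Submodule.mem_adjoint_iff, sub_eq_zero]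

theorem ker_le_orthogonal_range_adjoint [CompleteSpace H] {T : H →ₗ.[𝕜] H}
    (hT : Dense (T.domain : Set H)) :
    ker T ≤ (range T.adjoint)ᗮ := by
  intro x hx
  rw [mem_ker_iff_mem_graph] at hx
  rw [Submodule.mem_orthogonal']
  intro z hz
  obtain ⟨y, hy⟩ := mem_range_iff_exists_mem_graph.1 hz
  rw [← (mem_graph_adjoint_iff hT).1 hy _ _ hx, inner_zero_left]

/-- For a closed operator `R(T*)ᗮ ⊆ N(T)`: a vector `(x, 0)` with `x` orthogonal to `R(T*)` is
orthogonal to the orthogonal complement of the graph of `T`, hence lies in the graph. -/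
theorem orthogonal_range_adjoint_le_ker [CompleteSpace H] {T : H →ₗ.[𝕜] H}
    (hT : Dense (T.domain : Set H))
    (hc : T.IsClosed) : (range T.adjoint)ᗮ ≤ ker T := by
  intro x hx
  rw [mem_ker_iff_mem_graph]
  set K : Submodule 𝕜 (WithLp 2 (H × H)) :=
    T.graph.comap (WithLp.linearEquiv 2 𝕜 (H × H)).toLinearMap with hK
  have hKc : IsClosed (K : Set (WithLp 2 (H × H))) :=
    IsClosed.preimage (WithLp.prod_continuous_ofLp 2 H H) hc
  have : CompleteSpace K := hKc.completeSpace_coe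
  suffices h : WithLp.toLp 2 (x, (0 : H)) ∈ K by simpa [hK] using h
  rw [← Submodule.orthogonal_orthogonal K, Submodule.mem_orthogonal]
  intro u hu
  rw [Submodule.mem_orthogonal] at hu
  have hadj : (u.snd, -u.fst) ∈ T.adjoint.graph := by
    rw [mem_graph_adjoint_iff hT]
    intro a b hab
    have h := hu (WithLp.toLp 2 (a, b)) hab
    rw [WithLp.prod_inner_apply] at h
    simp only [inner_neg_right]
    exact eq_neg_of_add_eq_zero_right h
  have h := hx _ (mem_range_iff_exists_mem_graph.2 ⟨_, hadj⟩)
  rw [inner_neg_left, neg_eq_zero] at h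
  simp [WithLp.prod_inner_apply, h]

theorem isClosed_of_hasOrthogonalProjection (R : Submodule 𝕜 H) [R.HasOrthogonalProjection] :
    IsClosed (R : Set H) := by
  rw [← R.orthogonal_orthogonal]
  exact Rᗮ.isClosed_orthogonal

/-! ### Operators with a bounded reduced inverse -/

/-- The operator `T` is the orthogonal direct sum of `0` on `Rᗮ` and of a bijection from
`D(T) ∩ R` onto `R` whose inverse is the restriction to `R` of the bounded operator `C`, which
vanishes on `Rᗮ`. This is expressed by the graph: `T x = y` means that `y ∈ R` and that `C y` is
the orthogonal projection of `x` onto `R`. -/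
structure HasReducedInverse (T : H →ₗ.[𝕜] H) (R : Submodule 𝕜 H) [R.HasOrthogonalProjection]
    (C : H →L[𝕜] H) : Prop where
  map_mem : ∀ x, C x ∈ R
  map_orthogonal : ∀ x ∈ Rᗮ, C x = 0
  mem_graph_iff : ∀ x y, (x, y) ∈ T.graph ↔ y ∈ R ∧ R.starProjection x = C y

namespace HasReducedInverse

variable {T S : H →ₗ.[𝕜] H} {R : Submodule 𝕜 H} [R.HasOrthogonalProjection] {C D : H →L[𝕜] H}

theorem starProjection_map (h : HasReducedInverse T R C) (x : H) :
    R.starProjection (C x) = C x :=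
  Submodule.starProjection_eq_self_iff.2 (h.map_mem x)

theorem map_mem_graph (h : HasReducedInverse T R C) {y : H} (hy : y ∈ R) :
    (C y, y) ∈ T.graph :=
  (h.mem_graph_iff _ _).2 ⟨hy, h.starProjection_map y⟩

theorem ker_eq (h : HasReducedInverse T R C) : ker T = Rᗮ := by
  ext x
  simp [mem_ker_iff_mem_graph, h.mem_graph_iff, Submodule.starProjection_apply_eq_zero_iff]

theorem range_eq (h : HasReducedInverse T R C) : range T = R := by
  ext y
  rw [mem_range_iff_exists_mem_graph]
  exact ⟨fun ⟨x, hx⟩ => ((h.mem_graph_iff _ _).1 hx).1, fun hy => ⟨_, h.map_mem_graph hy⟩⟩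

theorem eq_zero_of_map_eq_zero (h : HasReducedInverse T R C) {y : H} (hy : y ∈ R)
    (h0 : C y = 0) : y = 0 := by
  have := h.map_mem_graph hy
  rw [h0] at this
  exact T.graph_fst_eq_zero_snd this rfl

theorem adjoint_map_mem [CompleteSpace H] (h : HasReducedInverse T R C) (x : H) :
    C.adjoint x ∈ R := by
  rw [← R.orthogonal_orthogonal, Submodule.mem_orthogonal]
  intro u hu
  rw [ContinuousLinearMap.adjoint_inner_right, h.map_orthogonal u hu, inner_zero_left]

theorem adjoint_map_orthogonal [CompleteSpace H] (h : HasReducedInverse T R C) (x : H)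
    (hx : x ∈ Rᗮ) :
    C.adjoint x = 0 := by
  apply ext_inner_left 𝕜
  intro v
  rw [ContinuousLinearMap.adjoint_inner_right, inner_zero_right]
  exact hx _ (h.map_mem v)

theorem isClosed (h : HasReducedInverse T R C) : T.IsClosed := by
  have hg : (T.graph : Set (H × H)) =
      {p | p.2 ∈ (R : Set H)} ∩ {p | R.starProjection p.1 = C p.2} := by
    ext ⟨x, y⟩
    exact h.mem_graph_iff x y
  rw [LinearPMap.IsClosed, hg]
  exact ((isClosed_of_hasOrthogonalProjection R).preimage continuous_snd).inter
    (isClosed_eq (by fun_prop) (by fun_prop))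

theorem adjoint [CompleteSpace H] (h : HasReducedInverse T R C) (hT : Dense (T.domain : Set H)) :
    HasReducedInverse T.adjoint R C.adjoint where
  map_mem := h.adjoint_map_mem
  map_orthogonal := h.adjoint_map_orthogonal
  mem_graph_iff y z := by
    rw [mem_graph_adjoint_iff hT]
    constructor
    · intro H1
      have hz : z ∈ R := by
        rw [← R.orthogonal_orthogonal, Submodule.mem_orthogonal]
        intro u hu
        rw [← h.ker_eq, mem_ker_iff_mem_graph] at hu
        rw [← H1 _ _ hu, inner_zero_left]
      refine ⟨hz, ?_⟩
      refine Submodule.eq_starProjection_of_mem_orthogonal (h.adjoint_map_mem z) ?_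
      rw [Submodule.mem_orthogonal]
      intro v hv
      rw [inner_sub_right, ContinuousLinearMap.adjoint_inner_right,
        H1 _ _ (h.map_mem_graph hv), sub_self]
    · rintro ⟨hz, hy⟩ a b hab
      obtain ⟨hb, ha⟩ := (h.mem_graph_iff _ _).1 hab
      calc ⟪b, y⟫ = ⟪R.starProjection b, y⟫ := by rw [Submodule.starProjection_eq_self_iff.2 hb]
        _ = ⟪b, C.adjoint z⟫ := by rw [Submodule.inner_starProjection_left_eq_right, hy]
        _ = ⟪R.starProjection a, z⟫ := by rw [ContinuousLinearMap.adjoint_inner_right, ha]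
        _ = ⟪a, z⟫ := by
          rw [Submodule.inner_starProjection_left_eq_right,
            Submodule.starProjection_eq_self_iff.2 hz]

/-- `D(T)` contains `Rᗮ` and the range of `C`, so it is dense as soon as `C*` is injective
on `R`. -/
theorem dense_domain [CompleteSpace H] (h : HasReducedInverse T R C)
    (hinj : ∀ y ∈ R, C.adjoint y = 0 → y = 0) : Dense (T.domain : Set H) := by
  rw [Submodule.dense_iff_topologicalClosure_eq_top,
    Submodule.topologicalClosure_eq_top_iff, Submodule.eq_bot_iff]
  intro z hz
  have hz' : ∀ a b, (a, b) ∈ T.graph → ⟪a, z⟫ = 0 := fun a b hab =>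
    hz a (LinearPMap.mem_domain_of_mem_graph hab)
  have hzR : z ∈ R := by
    rw [← R.orthogonal_orthogonal, Submodule.mem_orthogonal]
    intro u hu
    rw [← h.ker_eq, mem_ker_iff_mem_graph] at hu
    exact hz' _ _ hu
  apply hinj z hzR
  rw [← inner_self_eq_zero (𝕜 := 𝕜), ContinuousLinearMap.adjoint_inner_right]
  exact hz' _ _ (h.map_mem_graph (h.adjoint_map_mem z))

theorem comp (hT : HasReducedInverse T R C) (hS : HasReducedInverse S R D) :
    HasReducedInverse (UnboundedOp.comp T S) R (D * C) where
  map_mem x := hS.map_mem _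
  map_orthogonal x hx := by simp [hT.map_orthogonal x hx]
  mem_graph_iff x z := by
    simp only [mem_graph_comp_iff, hT.mem_graph_iff, hS.mem_graph_iff,
      mul_apply_eq_comp]
    constructor
    · rintro ⟨y, ⟨hy, hxy⟩, hz, hyz⟩
      rw [Submodule.starProjection_eq_self_iff.2 hy] at hyz
      exact ⟨hz, hyz ▸ hxy⟩
    · rintro ⟨hz, hxz⟩
      exact ⟨C z, ⟨hT.map_mem z, hxz⟩, hz, hT.starProjection_map z⟩

theorem pow_succ (h : HasReducedInverse T R C) (n : ℕ) :
    HasReducedInverse (UnboundedOp.pow T (n + 1)) R (C ^ (n + 1)) := by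
  induction n with
  | zero => simpa [UnboundedOp.pow, comp_id_toPMap_top] using h
  | succ n ih =>
    rw [_root_.pow_succ]
    exact h.comp ih

/-- The powers with positive exponent are densely defined, since `(C ^ n)* = (C*) ^ n` and `C*`
is injective on `R`. -/
theorem dense_domain_pow_succ [CompleteSpace H] (h : HasReducedInverse T R C)
    (hT : Dense (T.domain : Set H))
    (n : ℕ) : Dense ((UnboundedOp.pow T (n + 1)).domain : Set H) := by
  refine (h.pow_succ n).dense_domain fun y hy h0 => ?_
  rw [← ContinuousLinearMap.star_eq_adjoint, star_pow, ContinuousLinearMap.star_eq_adjoint] at h0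
  exact ((h.adjoint hT).pow_succ n).eq_zero_of_map_eq_zero hy h0

/-! ### The Moore-Penrose inverse and the Cauchy dual -/

theorem mpInverse_eq (h : HasReducedInverse T R C) :
    mpInverse T = (C : H →ₗ[𝕜] H).toPMap ⊤ := by
  have hdom : (carrierRestrict T).inverse.domain = R := by
    rw [LinearPMap.inverse_domain]
    ext y
    constructor
    · rintro ⟨⟨x, hx⟩, rfl⟩
      have hx' : x ∈ (ker T)ᗮ ⊓ T.domain := hx
      rw [← h.range_eq]
      exact ⟨⟨x, hx'.2⟩, rfl⟩
    · intro hy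
      obtain ⟨hd, hv⟩ := mem_graph_iff_exists_mem_domain.1 (h.map_mem_graph hy)
      have hx : C y ∈ (ker T)ᗮ ⊓ T.domain := by
        rw [h.ker_eq, R.orthogonal_orthogonal]
        exact ⟨h.map_mem y, hd⟩
      exact ⟨⟨C y, hx⟩, hv⟩
  apply LinearPMap.eq_of_le_of_domain_eq
  · apply LinearPMap.sup_le
    · refine ⟨le_top, ?_⟩
      rintro ⟨y, hy⟩ ⟨y', hy'⟩ (rfl : y = y')
      change _ = C y
      obtain ⟨⟨x, hx⟩, hxy⟩ := (LinearPMap.inverse_domain (f := carrierRestrict T)) ▸ hy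
      rw [LinearPMap.inverse_apply_eq (ker_carrierRestrict T)
        (y := ⟨y, hy⟩) (x := ⟨x, hx⟩) hxy]
      have hx' : x ∈ (ker T)ᗮ ⊓ T.domain := hx
      have hg : (x, y) ∈ T.graph := mem_graph_iff_exists_mem_domain.2 ⟨hx'.2, hxy⟩
      have hxR := hx'.1
      rw [h.ker_eq, R.orthogonal_orthogonal] at hxR
      have := ((h.mem_graph_iff _ _).1 hg).2
      rwa [Submodule.starProjection_eq_self_iff.2 hxR] at this
    · refine ⟨le_top, ?_⟩
      rintro ⟨y, hy⟩ ⟨y', hy'⟩ (rfl : y = y')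
      have hy'' : y ∈ (range T)ᗮ := hy
      rw [h.range_eq] at hy''
      exact (h.map_orthogonal y hy'').symm
  · rw [mpInverse, LinearPMap.domain_sup, hdom, LinearMap.toPMap_domain,
      LinearMap.toPMap_domain, h.range_eq]
    exact Submodule.sup_orthogonal_of_hasOrthogonalProjection

theorem cauchyDual_eq [CompleteSpace H] (h : HasReducedInverse T R C)
    (hT : Dense (T.domain : Set H)) :
    cauchyDual T = (C.adjoint : H →ₗ[𝕜] H).toPMap ⊤ := by
  apply LinearPMap.eq_of_eq_graph
  ext ⟨x, z⟩
  rw [cauchyDual, ((h.adjoint hT).comp h).mpInverse_eq, mem_graph_comp_iff]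
  simp only [mem_graph_toPMap_top_iff, exists_eq_left, h.mem_graph_iff,
    ContinuousLinearMap.coe_coe, mul_apply_eq_comp, h.starProjection_map]
  constructor
  · rintro ⟨hz, hC⟩
    refine sub_eq_zero.1 (h.eq_zero_of_map_eq_zero (R.sub_mem hz (h.adjoint_map_mem x)) ?_)
    rw [map_sub, hC, sub_self]
  · rintro rfl
    exact ⟨h.adjoint_map_mem x, rfl⟩

end HasReducedInverse

theorem hasReducedInverse_id :
    HasReducedInverse ((LinearMap.id : H →ₗ[𝕜] H).toPMap ⊤) ⊤ (1 : H →L[𝕜] H) where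
  map_mem x := Submodule.mem_top
  map_orthogonal x hx := by simpa using hx
  mem_graph_iff x y := by
    rw [mem_graph_toPMap_top_iff]
    simp [Submodule.starProjection_top, eq_comm]

/-! ### EP operators -/

/-- The reduced inverse of an EP operator is everywhere defined because `N(T) = Rᗮ`, and bounded
by the closed graph theorem. -/
theorem HasReducedInverse.of_isEP [CompleteSpace H] {T : H →ₗ.[𝕜] H} (hT : Dense (T.domain : Set H))
    (hc : T.IsClosed) {R : Submodule 𝕜 H} [R.HasOrthogonalProjection] (hR : range T = R)
    (hR' : range T.adjoint = R) : ∃ C : H →L[𝕜] H, HasReducedInverse T R C := by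
  have hker : ker T = Rᗮ := hR' ▸
    le_antisymm (ker_le_orthogonal_range_adjoint hT) (orthogonal_range_adjoint_le_ker hT hc)
  have hsub : ∀ x, (x - R.starProjection x, (0 : H)) ∈ T.graph := by
    intro x
    rw [← mem_ker_iff_mem_graph, hker]
    exact R.sub_starProjection_mem_orthogonal x
  have hproj : ∀ {x y}, (x, y) ∈ T.graph → (R.starProjection x, y) ∈ T.graph := by
    intro x y hxy
    simpa using T.graph.sub_mem hxy (hsub x)
  have huniq : ∀ {x x' y}, x ∈ R → x' ∈ R → (x, y) ∈ T.graph → (x', y) ∈ T.graph → x = x' := by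
    intro x x' y hx hx' h h'
    have h0 : (x - x', (0 : H)) ∈ T.graph := by simpa using T.graph.sub_mem h h'
    rw [← mem_ker_iff_mem_graph, hker] at h0
    exact sub_eq_zero.1 (inner_self_eq_zero.1 (h0 _ (R.sub_mem hx hx')))
  have hex : ∀ y, ∃ x ∈ R, (x, R.starProjection y) ∈ T.graph := by
    intro y
    obtain ⟨x, hx⟩ := mem_range_iff_exists_mem_graph.1 (hR.ge (R.starProjection_apply_mem y))
    exact ⟨_, R.starProjection_apply_mem x, hproj hx⟩
  choose f hfR hf using hex
  let L : H →ₗ[𝕜] H :=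
    { toFun := f
      map_add' := fun y y' => huniq (hfR _) (R.add_mem (hfR _) (hfR _)) (hf _) <| by
        simpa using T.graph.add_mem (hf y) (hf y')
      map_smul' := fun c y => huniq (hfR _) (R.smul_mem _ (hfR _)) (hf _) <| by
        simpa using T.graph.smul_mem c (hf y) }
  have hg : (L.graph : Set (H × H)) =
      {p | p.2 ∈ (R : Set H)} ∩ {p | (p.2, R.starProjection p.1) ∈ (T.graph : Set (H × H))} := by
    ext ⟨y, x⟩
    simp only [SetLike.mem_coe, LinearMap.mem_graph_iff, Set.mem_inter_iff, Set.mem_ofPred_eq]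
    constructor
    · rintro rfl
      exact ⟨hfR y, hf y⟩
    · rintro ⟨hx, h⟩
      exact huniq hx (hfR y) h (hf y)
  have hL : IsClosed (L.graph : Set (H × H)) := by
    rw [hg]
    exact ((isClosed_of_hasOrthogonalProjection R).preimage continuous_snd).inter
      (hc.preimage (by fun_prop))
  refine ⟨ContinuousLinearMap.ofIsClosedGraph hL, ?_, ?_, ?_⟩ <;>
    simp only [ContinuousLinearMap.coeFn_ofIsClosedGraph]
  · exact hfR
  · intro y hy
    refine huniq (hfR y) R.zero_mem (hf y) ?_
    rw [R.starProjection_apply_eq_zero_iff.2 hy]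
    exact T.graph.zero_mem
  · intro x y
    constructor
    · intro hxy
      have hy : y ∈ R := hR ▸ mem_range_iff_exists_mem_graph.2 ⟨x, hxy⟩
      have hfy := hf y
      rw [Submodule.starProjection_eq_self_iff.2 hy] at hfy
      exact ⟨hy, huniq (R.starProjection_apply_mem x) (hfR y) (hproj hxy) hfy⟩
    · rintro ⟨hy, hxy⟩
      have hfy := hf y
      rw [Submodule.starProjection_eq_self_iff.2 hy] at hfy
      have := T.graph.add_mem (hsub x) hfy
      have hxy' : R.starProjection x = f y := hxy
      simpa [← hxy'] using this

end UnboundedOp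

open UnboundedOp in
theorem theorem2p18 {𝕜 : Type*} [RCLike 𝕜] {H : Type*} [NormedAddCommGroup H]
    [InnerProductSpace 𝕜 H] [CompleteSpace H] (T : H →ₗ.[𝕜] H)
    (hdense : Dense (T.domain : Set H)) (hclosed : T.IsClosed)
    (hquasi : UnboundedOp.IsQuasinormal T) (hEP : UnboundedOp.IsEP T) (n : ℕ) :
    Dense ((UnboundedOp.pow T n).domain : Set H) ∧ (UnboundedOp.pow T n).IsClosed ∧
      UnboundedOp.cauchyDual (UnboundedOp.pow T n) =
        UnboundedOp.pow (UnboundedOp.cauchyDual T) n := by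
  have : CompleteSpace (range T) := hEP.1.completeSpace_coe
  obtain ⟨C, hC⟩ := HasReducedInverse.of_isEP hdense hclosed rfl hEP.2.symm
  cases n with
  | zero =>
    have hd : Dense ((UnboundedOp.pow T 0).domain : Set H) := by
      simp [UnboundedOp.pow]
    refine ⟨hd, hasReducedInverse_id.isClosed, ?_⟩
    refine (hasReducedInverse_id.cauchyDual_eq hd).trans ?_
    rw [← ContinuousLinearMap.star_eq_adjoint, star_one]
    rfl
  | succ n =>
    have hd := hC.dense_domain_pow_succ hdense n
    refine ⟨hd, (hC.pow_succ n).isClosed, ?_⟩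
    rw [(hC.pow_succ n).cauchyDual_eq hd, hC.cauchyDual_eq hdense, pow_toPMap_top,
      ← ContinuousLinearMap.star_eq_adjoint, star_pow, ContinuousLinearMap.star_eq_adjoint,
      ContinuousLinearMap.toLinearMap_pow]
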